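/- Let $\Phi:[0,\infty[\to[0,\infty]$ be convex and lower semicontinuous with $\Phi(0)<\infty$, $\Phi(x_0)<\infty$ for some $x_0>1$, $\inf_{x\ge 0}\Phi(x)=0$ and $\lim_{x\to\infty}\Phi(x)/x=\infty$, and let $\Phi^*(y)=\sup_{x\ge 0}(xy-\Phi(x))$, $y\in\mathbb R$, be its (finite) Fenchel--Legendre transform. Let $\Theta\subseteq\mathbb R^m$ be compact, let $\mathbb P^Z$ be a Borel probability measure on $\mathbb R^d$ (the distribution of a $d$-dimensional random vector $Z$), and let $G:\Theta\times\mathbb R^d\to\mathbb R$ have the piecewise linear form $$G(\theta,z)=\sum_{i=1}^r f^i(\theta,z)\,\big(\Lambda_i(T(\theta)+z)+b_i\big),\qquad f^i(\theta,z)=\min_{l=1,\dots,s_i}\mathbf 1_{I_{il}}\big(L^i_l(T(\theta)+z)+a^i_l\big),$$ where $r,s_1,\dots,s_r\ge 1$ are integers, $b_i,a^i_l\in\mathbb R$, the maps $\Lambda_i,L^i_l:\mathbb R^d\to\mathbb R$ and $T:\mathbb R^m\to\mathbb R^d$ are linear, $]0,\infty[\,\subseteq I_{il}\subseteq[0,\infty[$,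 and for all $\theta\in\Theta$, $z\in\mathbb R^d$ one has $f^i(\theta,z)f^j(\theta,z)=0$ for $i\ne j$ and $\sum_{i=1}^r f^i(\theta,z)=1$. For $k\in\mathbb N$ let $\mathbb F_k$ be the set of all functions $z\mapsto\Phi^*(G(\theta,z)+x)$ on $\mathbb R^d$ with $\theta\in\Theta$ and $x\in[-k,k]$, and for $\delta>0$ let $\mathbb F_{k,\delta}=\{h\wedge\delta : h\in\mathbb F_k\}$. Let $\mathcal M_{\rm fin}$ be the set of Borel probability measures on $\mathbb R^d$ with finite support, let $\|\cdot\|_{\mathbb Q,2}$ be the norm of $L^2(\mathbb Q)$, and let $N(\eta,\mathbb F,L^2(\mathbb Q))$ be the minimal number of open $\|\cdot\|_{\mathbb Q,2}$-balls of radius $\eta$ with centers in $\mathbb F$ needed to cover $\mathbb F$ ($\infty$ if there is no finite cover). A positive envelope of $\mathbb F$ is a Borel measurable $C:\mathbb R^d\to\,]0,\infty[$ with $|h|\le C$ for all $h\in\mathbb F$. Then for every $k\in\mathbb N$ there exist $K_k,V_k>1$ and a positive envelope $C_{\mathbb F_k}$ of $\mathbb F_k$ such that $$\sup_{\mathbb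 Q\in\mathcal M_{\rm fin}}N\big(\varepsilon\|C_{\mathbb F_k}\|_{\mathbb Q,2},\mathbb F_k,L^2(\mathbb Q)\big)\le K_k\Big(\frac1\varepsilon\Big)^{V_k}\quad\text{for }\varepsilon\in\,]0,1[,$$ $$\sup_{\mathbb Q\in\mathcal M_{\rm fin}}N\big(\varepsilon,\mathbb F_{k,\delta},L^2(\mathbb Q)\big)\le\Big(\frac{6rK_k[\delta+1+\Phi(0)]}{\varepsilon}\Big)^{V_k+1}\quad\text{for }\delta>0,\ 0<\varepsilon<6rK_k[\delta+1+\Phi(0)].$$ Moreover $C_{\mathbb F_k}$ may be chosen such that, in addition, it is square $\mathbb P^Z$-integrable whenever $\Phi^*(\Lambda_i+\eta)$ is square $\mathbb P^Z$-integrable for every $i\in\{1,\dots,r\}$ and $\eta>0$. -/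

import Mathlib

open scoped ENNReal NNReal Topology

namespace SAA

/-- Standing assumptions on the divergence function `Φ : [0,∞[ → [0,∞]`. -/
structure IsDivergenceFunction (Φ : ℝ≥0 → ℝ≥0∞) : Prop where
  lsc : LowerSemicontinuous Φ
  convex : ConvexOn ℝ≥0 Set.univ Φ
  zero_ne_top : Φ 0 ≠ ∞
  exists_gt_one : ∃ x₀ : ℝ≥0, 1 < x₀ ∧ Φ x₀ ≠ ∞
  iInf_eq_zero : ⨅ x, Φ x = 0
  growth : Filter.Tendsto (fun x : ℝ≥0 => Φ x / (x : ℝ≥0∞)) Filter.atTop (𝓝 ∞)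

/-- The Fenchel-Legendre transform `y ↦ sup_{x ≥ 0} (x y - Φ x)` in the extended reals. -/
noncomputable def fenchel (Φ : ℝ≥0 → ℝ≥0∞) (y : ℝ) : EReal :=
  ⨆ x : ℝ≥0, (((x : ℝ) * y : ℝ) : EReal) - ((Φ x : ℝ≥0∞) : EReal)

/-- The Fenchel-Legendre transform as a real-valued function. It is finite for every divergence
function, see `IsDivergenceFunction.coe_conj`. -/
noncomputable def conj (Φ : ℝ≥0 → ℝ≥0∞) (y : ℝ) : ℝ := (fenchel Φ y).toReal

theorem IsDivergenceFunction.coe_conj {Φ : ℝ≥0 → ℝ≥0∞} (hΦ : IsDivergenceFunction Φ) (y : ℝ) :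
    ((conj Φ y : ℝ) : EReal) = fenchel Φ y := by
  apply EReal.coe_toReal
  · obtain ⟨M, hM⟩ := Filter.eventually_atTop.1
      (hΦ.growth.eventually (lt_mem_nhds (ENNReal.coe_lt_top (r := ‖y‖₊))))
    have hle : fenchel Φ y ≤ (((M : ℝ) * |y| : ℝ) : EReal) := by
      refine iSup_le fun x => ?_
      have hxy : (x : ℝ) * y ≤ x * |y| := mul_le_mul_of_nonneg_left (le_abs_self y) x.2
      rcases le_total M x with hx | hx
      · have h1 : (‖y‖₊ : ℝ≥0∞) * x ≤ Φ x := ENNReal.mul_le_of_le_div (hM x hx).le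
        have h2 : (((x : ℝ) * y : ℝ) : EReal) ≤ (Φ x : EReal) := by
          refine le_trans ?_ (EReal.coe_ennreal_le_coe_ennreal_iff.2 h1)
          have : ((‖y‖₊ : ℝ≥0∞) * x : ℝ≥0∞) = ((‖y‖₊ * x : ℝ≥0) : ℝ≥0∞) := by push_cast; rfl
          rw [this, EReal.coe_nnreal_eq_coe_real]
          rw [EReal.coe_le_coe_iff]
          simpa [mul_comm] using hxy
        refine le_trans (EReal.sub_nonpos.2 h2) ?_
        exact_mod_cast mul_nonneg M.2 (abs_nonneg y)
      · refine le_trans (EReal.sub_le_sub (le_refl _) (EReal.coe_ennreal_nonneg (Φ x))) ?_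
        rw [sub_zero, EReal.coe_le_coe_iff]
        exact hxy.trans (mul_le_mul_of_nonneg_right hx (abs_nonneg y))
    exact ne_top_of_le_ne_top (EReal.coe_ne_top _) hle
  · have h0 : (((0 : ℝ≥0) : ℝ) * y : ℝ) - ((Φ 0 : ℝ≥0∞) : EReal) ≤ fenchel Φ y :=
      le_iSup (fun x : ℝ≥0 => (((x : ℝ) * y : ℝ) : EReal) - ((Φ x : ℝ≥0∞) : EReal)) 0
    refine ne_bot_of_le_ne_bot ?_ h0
    lift Φ 0 to ℝ≥0 using hΦ.zero_ne_top with c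
    rw [EReal.coe_nnreal_eq_coe_real, ← EReal.coe_sub]
    exact EReal.coe_ne_bot _

/-- The data of a piecewise linear representation of a goal function on `ℝ^m × ℝ^d`. -/
structure PLData (m d : ℕ) where
  r : ℕ
  s : Fin r → ℕ
  b : Fin r → ℝ
  a : (i : Fin r) → Fin (s i) → ℝ
  Λ : Fin r → EuclideanSpace ℝ (Fin d) →ₗ[ℝ] ℝ
  L : (i : Fin r) → Fin (s i) → EuclideanSpace ℝ (Fin d) →ₗ[ℝ] ℝ
  T : EuclideanSpace ℝ (Fin m) →ₗ[ℝ] EuclideanSpace ℝ (Fin d)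
  I : (i : Fin r) → Fin (s i) → Set ℝ

/-- `min_{l = 1,…,s_i} 1_{I_{il}} (L^i_l (T θ + z) + a^i_l)`. -/
noncomputable def PLData.selector {m d : ℕ} (D : PLData m d) (i : Fin D.r)
    (θ : EuclideanSpace ℝ (Fin m)) (z : EuclideanSpace ℝ (Fin d)) : ℝ :=
  ⨅ l : Fin (D.s i), (D.I i l).indicator (fun _ => (1 : ℝ)) (D.L i l (D.T θ + z) + D.a i l)

/-- `G` has on `Θ × ℝ^d` the piecewise linear representation with data `D`. -/
structure IsPL {m d : ℕ} (Θ : Set (EuclideanSpace ℝ (Fin m)))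
    (G : EuclideanSpace ℝ (Fin m) → EuclideanSpace ℝ (Fin d) → ℝ) (D : PLData m d) : Prop where
  r_pos : 0 < D.r
  s_pos : ∀ i, 0 < D.s i
  Ioi_subset : ∀ i l, Set.Ioi 0 ⊆ D.I i l
  subset_Ici : ∀ i l, D.I i l ⊆ Set.Ici 0
  selector_mul : ∀ θ ∈ Θ, ∀ z, ∀ i j, i ≠ j → D.selector i θ z * D.selector j θ z = 0
  selector_sum : ∀ θ ∈ Θ, ∀ z, ∑ i, D.selector i θ z = 1
  eq_sum : ∀ θ ∈ Θ, ∀ z, G θ z = ∑ i, D.selector i θ z * (D.Λ i (D.T θ + z) + D.b i)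

/-- The class `F_k` of all maps `z ↦ Φ* (G(θ,z) + x)` with `θ ∈ Θ` and `x ∈ [-k,k]`. -/
def lossClass {m d : ℕ} (Φ : ℝ≥0 → ℝ≥0∞) (Θ : Set (EuclideanSpace ℝ (Fin m)))
    (G : EuclideanSpace ℝ (Fin m) → EuclideanSpace ℝ (Fin d) → ℝ) (k : ℕ) :
    Set (EuclideanSpace ℝ (Fin d) → ℝ) :=
  {h | ∃ θ ∈ Θ, ∃ x ∈ Set.Icc (-(k : ℝ)) k, h = fun z => conj Φ (G θ z + x)}

/-- The truncated class `{h ∧ δ | h ∈ F}`. -/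
def truncClass {X : Type*} (F : Set (X → ℝ)) (δ : ℝ) : Set (X → ℝ) :=
  (fun h z => min (h z) δ) '' F

/-- `N(η, F, L²(Q))`: the minimal number of open `L²(Q)`-balls of radius `η` with centers in `F`
that cover `F`, and `⊤` if there is no finite cover. -/
noncomputable def coveringNumber {X : Type*} [MeasurableSpace X] (η : ℝ≥0∞) (F : Set (X → ℝ))
    (Q : MeasureTheory.Measure X) : ℕ∞ :=
  ⨅ (S : Finset (X → ℝ)) (_ : (S : Set (X → ℝ)) ⊆ F ∧
    ∀ h ∈ F, ∃ g ∈ S, MeasureTheory.eLpNorm (h - g) 2 Q < η), (S.card : ℕ∞)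

/-- The Borel probability measures on `ℝ^d` with finite support. -/
def finSupportMeasures (d : ℕ) : Set (MeasureTheory.Measure (EuclideanSpace ℝ (Fin d))) :=
  {Q | MeasureTheory.IsProbabilityMeasure Q ∧
    ∃ S : Finset (EuclideanSpace ℝ (Fin d)), Q (S : Set (EuclideanSpace ℝ (Fin d)))ᶜ = 0}

/-- `C` is a positive envelope of `F`. -/
structure IsPositiveEnvelope {X : Type*} [MeasurableSpace X] (F : Set (X → ℝ)) (C : X → ℝ) :
    Prop where
  measurable : Measurable C
  pos : ∀ z, 0 < C z
  abs_le : ∀ h ∈ F, ∀ z, |h z| ≤ C z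

end SAA

/-! `Φ*` is nondecreasing and bounded below by `-Φ(0)`. Since the `Λ_i` and `L^i_l` are linear, `θ`
and `x` enter each piece `Φ*(Λ_i(Tθ+z)+b_i+x)` and each indicator only through a real shift of the
argument of a monotone function. Each such family is therefore a chain: totally ordered pointwise.

Chains are easy to cover. If `f ≥ g` and both are bounded by `C`, then `(f-g)² ≤ 2C(f-g)`, so the
squared `L²(Q)` distance is at most twice the difference of the numbers `∫ C f dQ` and `∫ C g dQ`.
These numbers lie in `[-A, A]` with `A = ‖C‖²`, and cutting that interval into `n` cells covers the
chain uniformly in `Q` (`sum_mul_sq_sub_le`).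

Increments of the loss are dominated by the sum of the increments of `J = ∑ (s_i + 1)` chains, so
recording one cell per chain gives at most `n^J` balls once `n > 4J²/ε²`
(`coveringNumber_range_le_of_chains`, `IsPL.coveringNumber_le`). The truncated class is the same
argument for the monotone function `Φ* ∧ δ` with a constant envelope. -/

namespace SAA

open MeasureTheory

/-! ### Monotonicity and lower bound of the conjugate -/

section Fenchel

theorem IsDivergenceFunction.conj_monotone {Φ : ℝ≥0 → ℝ≥0∞} (hΦ : IsDivergenceFunction Φ) :
    Monotone (conj Φ) := by
  intro y y' hyy'
  rw [← EReal.coe_le_coe_iff, hΦ.coe_conj, hΦ.coe_conj]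
  refine iSup_mono fun x => EReal.sub_le_sub ?_ le_rfl
  exact EReal.coe_le_coe_iff.2 (mul_le_mul_of_nonneg_left hyy' x.2)

theorem IsDivergenceFunction.neg_le_conj {Φ : ℝ≥0 → ℝ≥0∞} (hΦ : IsDivergenceFunction Φ) (y : ℝ) :
    -(Φ 0).toReal ≤ conj Φ y := by
  rw [← EReal.coe_le_coe_iff, hΦ.coe_conj]
  refine le_trans (le_of_eq ?_)
    (le_iSup (fun x : ℝ≥0 => (((x : ℝ) * y : ℝ) : EReal) - ((Φ x : ℝ≥0∞) : EReal)) 0)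
  have h0 := hΦ.zero_ne_top
  lift Φ 0 to ℝ≥0 using h0 with c
  rw [EReal.coe_nnreal_eq_coe_real, ← EReal.coe_sub]
  simp

end Fenchel

/-! ### `L²` norms as finite weighted sums -/

section FiniteSupport

variable {X : Type*} [MeasurableSpace X] [MeasurableSingletonClass X]

theorem eLpNorm_two_eq_sqrt_sum {Q : Measure X} [IsProbabilityMeasure Q] {S : Finset X}
    (hS : Q (S : Set X)ᶜ = 0) (f : X → ℝ) :
    eLpNorm f 2 Q = ENNReal.ofReal (√(∑ x ∈ S, (Q {x}).toReal * f x ^ 2)) := by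
  have hQ : Q = Q.restrict (S : Set X) := (Measure.restrict_eq_self_of_ae_mem hS).symm
  have hnn : 0 ≤ ∑ x ∈ S, (Q {x}).toReal * f x ^ 2 :=
    Finset.sum_nonneg fun x _ => mul_nonneg ENNReal.toReal_nonneg (sq_nonneg _)
  rw [eLpNorm_eq_lintegral_rpow_enorm_toReal two_ne_zero ENNReal.ofNat_ne_top, Real.sqrt_eq_rpow,
    ← ENNReal.ofReal_rpow_of_nonneg hnn (by norm_num)]
  congr 1
  conv_lhs => rw [hQ]
  rw [lintegral_finset, ENNReal.ofReal_sum_of_nonneg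
    fun x _ => mul_nonneg ENNReal.toReal_nonneg (sq_nonneg _)]
  refine Finset.sum_congr rfl fun x _ => ?_
  rw [ENNReal.ofReal_mul ENNReal.toReal_nonneg, ENNReal.ofReal_toReal (measure_ne_top _ _),
    mul_comm]
  congr 1
  rw [← sq_abs, ENNReal.ofReal_pow (abs_nonneg _), ← Real.norm_eq_abs, ofReal_norm]
  simp

theorem sum_toReal_singleton_eq_one {Q : Measure X} [IsProbabilityMeasure Q] {S : Finset X}
    (hS : Q (S : Set X)ᶜ = 0) : ∑ x ∈ S, (Q {x}).toReal = 1 := by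
  rw [← ENNReal.toReal_sum fun x _ => measure_ne_top _ _, sum_measure_singleton,
    (prob_compl_eq_zero_iff S.measurableSet).1 hS, ENNReal.toReal_one]

end FiniteSupport

/-! ### Covering numbers from totally ordered families -/

section Chains

/-- Index of the cell of the partition of `[0, n]` into unit intervals that contains `y`. -/
noncomputable def unitCell (n : ℕ) (y : ℝ) : ℕ := min ⌊y⌋₊ (n - 1)

theorem unitCell_lt {n : ℕ} (hn : 0 < n) (y : ℝ) : unitCell n y < n := by
  unfold unitCell; omega

theorem unitCell_le {n : ℕ} {y : ℝ} (hy : 0 ≤ y) : (unitCell n y : ℝ) ≤ y :=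
  le_trans (by exact_mod_cast min_le_left _ _) (Nat.floor_le hy)

/-- Capping the index at `n - 1` puts the endpoint `y = n` into the last cell. -/
theorem le_unitCell_add_one {n : ℕ} (hn : 0 < n) {y : ℝ} (hy : y ≤ n) :
    y ≤ unitCell n y + 1 := by
  unfold unitCell
  rcases min_choice ⌊y⌋₊ (n - 1) with h | h <;> rw [h]
  · exact (Nat.lt_floor_add_one y).le
  · rw [Nat.cast_sub hn]; simpa using hy

theorem abs_sub_le_of_unitCell_eq {n : ℕ} (hn : 0 < n) {y y' : ℝ} (hy0 : 0 ≤ y) (hy : y ≤ n)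
    (hy0' : 0 ≤ y') (hy' : y' ≤ n) (h : unitCell n y = unitCell n y') : |y - y'| ≤ 1 := by
  have h1 := unitCell_le (n := n) hy0
  have h2 := unitCell_le (n := n) hy0'
  have h3 := le_unitCell_add_one hn hy
  have h4 := le_unitCell_add_one hn hy'
  rw [h] at h1 h3
  rw [abs_le]; constructor <;> linarith

/-- Centers must belong to the class, so one member is chosen for each attained code; hence the
hypothesis compares two members rather than a member and a cell center. -/
theorem coveringNumber_range_le_card {X ι κ : Type*} [MeasurableSpace X] [Fintype κ]
    {η : ℝ≥0∞} {Q : Measure X} (h : ι → X → ℝ) (c : ι → κ)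
    (hc : ∀ p q, c p = c q → eLpNorm (h p - h q) 2 Q < η) :
    coveringNumber η (Set.range h) Q ≤ Fintype.card κ := by
  classical
  let S : Finset (X → ℝ) := (Finset.univ : Finset (Set.range c)).image
    fun v => h v.2.choose
  have hS : (S : Set (X → ℝ)) ⊆ Set.range h ∧
      ∀ g ∈ Set.range h, ∃ g' ∈ S, eLpNorm (g - g') 2 Q < η := by
    constructor
    · intro g hg
      obtain ⟨v, -, rfl⟩ := Finset.mem_image.1 hg
      exact ⟨_, rfl⟩
    · rintro _ ⟨p, rfl⟩
      have hp : c p ∈ Set.range c := ⟨p, rfl⟩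
      refine ⟨h hp.choose, Finset.mem_image.2 ⟨⟨c p, hp⟩, Finset.mem_univ _, rfl⟩, ?_⟩
      exact hc _ _ hp.choose_spec.symm
  refine (iInf₂_le S hS).trans ?_
  exact_mod_cast Finset.card_image_le.trans (Fintype.card_subtype_le _)

/-- For a pointwise totally ordered pair bounded by `C`, the weighted `L²` distance is controlled by
the difference of the integrals against `C`. -/
theorem sum_mul_sq_sub_le {X : Type*} {S : Finset X} {w C f g : X → ℝ} (hw : ∀ x, 0 ≤ w x)
    (hf : ∀ x, |f x| ≤ C x) (hg : ∀ x, |g x| ≤ C x) (hfg : f ≤ g ∨ g ≤ f) :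
    ∑ x ∈ S, w x * (f x - g x) ^ 2
      ≤ 2 * |∑ x ∈ S, w x * (C x * f x) - ∑ x ∈ S, w x * (C x * g x)| := by
  wlog hle : g ≤ f generalizing f g with H
  · have := H hg hf hfg.symm (hfg.resolve_right hle)
    rw [abs_sub_comm]
    simpa only [sub_sq_comm] using this
  refine le_trans ?_ (mul_le_mul_of_nonneg_left (le_abs_self _) zero_le_two)
  rw [← Finset.sum_sub_distrib, Finset.mul_sum]
  refine Finset.sum_le_sum fun x _ => ?_
  have h1 : f x - g x ≤ 2 * C x := by linarith [(abs_le.1 (hf x)).2, (abs_le.1 (hg x)).1]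
  have h2 : 0 ≤ f x - g x := sub_nonneg.2 (hle x)
  nlinarith [mul_le_mul_of_nonneg_left h1 (mul_nonneg (hw x) h2)]

theorem abs_sum_mul_mul_le {X : Type*} {S : Finset X} {w C f : X → ℝ} (hw : ∀ x, 0 ≤ w x)
    (hf : ∀ x, |f x| ≤ C x) :
    |∑ x ∈ S, w x * (C x * f x)| ≤ ∑ x ∈ S, w x * C x ^ 2 := by
  refine (Finset.abs_sum_le_sum_abs _ _).trans (Finset.sum_le_sum fun x _ => ?_)
  have hC : 0 ≤ C x := (abs_nonneg _).trans (hf x)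
  rw [abs_mul, abs_mul, abs_of_nonneg (hw x), abs_of_nonneg hC, sq]
  exact mul_le_mul_of_nonneg_left (mul_le_mul_of_nonneg_left (hf x) hC) (hw x)

/-- Uniform covering bound for a class whose increments are controlled by finitely many chains with
common envelope `C`. -/
theorem coveringNumber_range_le_of_chains {X ι J : Type*} [MeasurableSpace X]
    [MeasurableSingletonClass X] [Fintype J] {Q : Measure X} [IsProbabilityMeasure Q]
    {S : Finset X} (hS : Q (S : Set X)ᶜ = 0) {C : X → ℝ} (hC : ∀ x, 0 < C x)
    (h : ι → X → ℝ) (u : J → ι → X → ℝ) (hu : ∀ j p x, |u j p x| ≤ C x)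
    (hchain : ∀ j p q, u j p ≤ u j q ∨ u j q ≤ u j p)
    (hh : ∀ p q x, |h p x - h q x| ≤ ∑ j, |u j p x - u j q x|)
    {ε : ℝ} (hε : 0 < ε) {n : ℕ} (hn : 4 * (Fintype.card J : ℝ) ^ 2 / ε ^ 2 < n) :
    coveringNumber (ENNReal.ofReal ε * eLpNorm C 2 Q) (Set.range h) Q
      ≤ ((n ^ Fintype.card J : ℕ) : ℕ∞) := by
  classical
  have hnR : (0 : ℝ) < n := lt_of_le_of_lt (by positivity) hn
  have hn0 : 0 < n := by exact_mod_cast hnR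
  set w : X → ℝ := fun x => (Q {x}).toReal with hw_def
  have hw : ∀ x, 0 ≤ w x := fun x => ENNReal.toReal_nonneg
  set A : ℝ := ∑ x ∈ S, w x * C x ^ 2 with hA_def
  -- Positivity of the envelope makes the final strict inequality possible.
  have hA : 0 < A := by
    have hsum : ∑ x ∈ S, w x = 1 := sum_toReal_singleton_eq_one hS
    obtain ⟨x, hxS, hx⟩ : ∃ x ∈ S, 0 < w x := by
      by_contra! H
      have := Finset.sum_nonpos H
      linarith
    exact Finset.sum_pos' (fun x _ => mul_nonneg (hw x) (sq_nonneg _))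
      ⟨x, hxS, mul_pos hx (pow_pos (hC x) 2)⟩
  let φ : J → ι → ℝ := fun j p => ∑ x ∈ S, w x * (C x * u j p x)
  have hφ : ∀ j p, |φ j p| ≤ A := fun j p => abs_sum_mul_mul_le hw (hu j p)
  -- Affine rescaling of `[-A, A]` to `[0, n]`: a unit cell corresponds to length `2A/n`.
  let y : J → ι → ℝ := fun j p => n * (φ j p + A) / (2 * A)
  have hy0 : ∀ j p, 0 ≤ y j p := fun j p =>
    div_nonneg (mul_nonneg hnR.le (by linarith [(abs_le.1 (hφ j p)).1])) (by positivity)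
  have hy1 : ∀ j p, y j p ≤ n := fun j p => by
    rw [div_le_iff₀ (by positivity)]
    exact mul_le_mul_of_nonneg_left (by linarith [(abs_le.1 (hφ j p)).2]) hnR.le
  let c : ι → J → Fin n := fun p j => ⟨unitCell n (y j p), unitCell_lt hn0 _⟩
  have key : ∀ p q, c p = c q → eLpNorm (h p - h q) 2 Q
      < ENNReal.ofReal ε * eLpNorm C 2 Q := by
    intro p q hpq
    have hφd : ∀ j, |φ j p - φ j q| ≤ 2 * A / n := by
      intro j
      have h1 := abs_sub_le_of_unitCell_eq hn0 (hy0 j p) (hy1 j p) (hy0 j q) (hy1 j q)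
        (congrArg Fin.val (congrFun hpq j))
      have h2 : y j p - y j q = n / (2 * A) * (φ j p - φ j q) := by
        simp only [y]; field_simp; ring
      rw [h2, abs_mul, abs_of_pos (by positivity)] at h1
      rw [le_div_iff₀ hnR]
      rw [div_mul_eq_mul_div, div_le_iff₀ (by positivity)] at h1
      linarith
    -- Cauchy–Schwarz over the chains costs one factor `J`, the sum over them another.
    have hsq : ∑ x ∈ S, w x * (h p x - h q x) ^ 2
        ≤ 4 * (Fintype.card J : ℝ) ^ 2 * A / n := by
      calc ∑ x ∈ S, w x * (h p x - h q x) ^ 2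
          ≤ ∑ x ∈ S, w x * (Fintype.card J * ∑ j, (u j p x - u j q x) ^ 2) := by
            refine Finset.sum_le_sum fun x _ => mul_le_mul_of_nonneg_left ?_ (hw x)
            have h1 : (h p x - h q x) ^ 2 ≤ (∑ j, |u j p x - u j q x|) ^ 2 :=
              sq_le_sq' (by linarith [neg_abs_le (h p x - h q x), hh p q x])
                ((le_abs_self _).trans (hh p q x))
            refine h1.trans ?_
            have := sq_sum_le_card_mul_sum_sq (s := (Finset.univ : Finset J))
              (f := fun j => |u j p x - u j q x|)
            simpa [sq_abs] using this
        _ = Fintype.card J * ∑ j, ∑ x ∈ S, w x * (u j p x - u j q x) ^ 2 := by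
            rw [Finset.sum_comm, Finset.mul_sum]
            refine Finset.sum_congr rfl fun x _ => ?_
            rw [← Finset.mul_sum]; ring
        _ ≤ Fintype.card J * ∑ _j : J, 2 * (2 * A / n) := by
            refine mul_le_mul_of_nonneg_left (Finset.sum_le_sum fun j _ => ?_) (Nat.cast_nonneg _)
            exact (sum_mul_sq_sub_le hw (hu j p) (hu j q) (hchain j p q)).trans
              (mul_le_mul_of_nonneg_left (hφd j) zero_le_two)
        _ = 4 * (Fintype.card J : ℝ) ^ 2 * A / n := by
            rw [Finset.sum_const, Finset.card_univ, nsmul_eq_mul]; ring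
    have hlt : ∑ x ∈ S, w x * (h p x - h q x) ^ 2 < ε ^ 2 * A := by
      refine hsq.trans_lt ?_
      rw [div_lt_iff₀ (by positivity)] at hn
      rw [div_lt_iff₀ hnR]
      nlinarith
    rw [eLpNorm_two_eq_sqrt_sum hS, eLpNorm_two_eq_sqrt_sum hS, ← ENNReal.ofReal_mul hε.le]
    have hpos : 0 < ε * √A := mul_pos hε (Real.sqrt_pos.2 hA)
    rw [ENNReal.ofReal_lt_ofReal_iff hpos, Real.sqrt_lt' hpos, mul_pow, Real.sq_sqrt hA.le]
    exact hlt
  simpa using coveringNumber_range_le_card h c key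

end Chains

/-! ### Chains generated by a piecewise linear goal function -/

section PiecewiseLinear

variable {m d : ℕ} {Θ : Set (EuclideanSpace ℝ (Fin m))}
  {G : EuclideanSpace ℝ (Fin m) → EuclideanSpace ℝ (Fin d) → ℝ} {D : PLData m d}

theorem IsPL.mem_of_le (hG : IsPL Θ G D) (i : Fin D.r) (l : Fin (D.s i)) {y y' : ℝ}
    (hy : y ∈ D.I i l) (h : y ≤ y') : y' ∈ D.I i l := by
  rcases h.eq_or_lt with rfl | h
  · exact hy
  · exact hG.Ioi_subset i l ((Set.mem_Ici.1 (hG.subset_Ici i l hy)).trans_lt h)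

theorem IsPL.indicator_monotone (hG : IsPL Θ G D) (i : Fin D.r) (l : Fin (D.s i)) :
    Monotone ((D.I i l).indicator fun _ => (1 : ℝ)) := by
  intro y y' h
  by_cases hy : y ∈ D.I i l
  · rw [Set.indicator_of_mem hy, Set.indicator_of_mem (hG.mem_of_le i l hy h)]
  · rw [Set.indicator_of_notMem hy]
    exact Set.indicator_nonneg (fun _ _ => zero_le_one) _

theorem indicator_one_eq_zero_or_one (I : Set ℝ) (y : ℝ) :
    I.indicator (fun _ => (1 : ℝ)) y = 0 ∨ I.indicator (fun _ => (1 : ℝ)) y = 1 := by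
  by_cases hy : y ∈ I <;> simp [hy]

theorem IsPL.selector_eq_zero_or_one (hG : IsPL Θ G D) (i : Fin D.r)
    (θ : EuclideanSpace ℝ (Fin m)) (z : EuclideanSpace ℝ (Fin d)) :
    D.selector i θ z = 0 ∨ D.selector i θ z = 1 := by
  have : Nonempty (Fin (D.s i)) := ⟨⟨0, hG.s_pos i⟩⟩
  obtain ⟨l, hl⟩ := exists_eq_ciInf_of_finite
    (f := fun l : Fin (D.s i) =>
      (D.I i l).indicator (fun _ => (1 : ℝ)) (D.L i l (D.T θ + z) + D.a i l))
  rw [PLData.selector, ← hl]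
  exact indicator_one_eq_zero_or_one _ _

/-- Selectors take values in `{0, 1}`; if two differ, some indicator differs too, and then by
exactly 1. -/
theorem IsPL.abs_selector_sub_le (hG : IsPL Θ G D) (i : Fin D.r)
    (θ θ' : EuclideanSpace ℝ (Fin m)) (z : EuclideanSpace ℝ (Fin d)) :
    |D.selector i θ z - D.selector i θ' z| ≤
      ∑ l, |(D.I i l).indicator (fun _ => (1 : ℝ)) (D.L i l (D.T θ + z) + D.a i l)
        - (D.I i l).indicator (fun _ => (1 : ℝ)) (D.L i l (D.T θ' + z) + D.a i l)| := by
  by_cases H : ∀ l, (D.I i l).indicator (fun _ => (1 : ℝ)) (D.L i l (D.T θ + z) + D.a i l)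
      = (D.I i l).indicator (fun _ => (1 : ℝ)) (D.L i l (D.T θ' + z) + D.a i l)
  · have : D.selector i θ z = D.selector i θ' z := iInf_congr H
    rw [this, sub_self, abs_zero]
    exact Finset.sum_nonneg fun _ _ => abs_nonneg _
  · push Not at H
    obtain ⟨l, hl⟩ := H
    have h1 : |D.selector i θ z - D.selector i θ' z| ≤ 1 := by
      rcases hG.selector_eq_zero_or_one i θ z with h | h <;>
      rcases hG.selector_eq_zero_or_one i θ' z with h' | h' <;> simp [h, h']
    refine h1.trans (le_trans ?_ (Finset.single_le_sum
      (fun l _ => abs_nonneg ((D.I i l).indicator (fun _ => (1 : ℝ)) (D.L i l (D.T θ + z) + D.a i l)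
        - (D.I i l).indicator (fun _ => (1 : ℝ)) (D.L i l (D.T θ' + z) + D.a i l)))
      (Finset.mem_univ l)))
    rcases indicator_one_eq_zero_or_one (D.I i l) (D.L i l (D.T θ + z) + D.a i l) with h | h <;>
    rcases indicator_one_eq_zero_or_one (D.I i l) (D.L i l (D.T θ' + z) + D.a i l) with h' | h' <;>
    rw [h, h'] at hl ⊢ <;> simp at hl ⊢

theorem IsPL.exists_active_piece (hG : IsPL Θ G D) {θ : EuclideanSpace ℝ (Fin m)}
    (hθ : θ ∈ Θ) (z : EuclideanSpace ℝ (Fin d)) :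
    ∃ i, D.selector i θ z = 1 ∧ (∀ j, j ≠ i → D.selector j θ z = 0) ∧
      G θ z = D.Λ i (D.T θ + z) + D.b i := by
  obtain ⟨i, hi⟩ : ∃ i, D.selector i θ z = 1 := by
    by_contra! H
    have h0 : ∀ i, D.selector i θ z = 0 := fun i =>
      (hG.selector_eq_zero_or_one i θ z).resolve_right (H i)
    have := hG.selector_sum θ hθ z
    simp [h0] at this
  have hj : ∀ j, j ≠ i → D.selector j θ z = 0 := fun j hji => by
    have := hG.selector_mul θ hθ z j i hji
    rwa [hi, mul_one] at this
  refine ⟨i, hi, hj, ?_⟩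
  rw [hG.eq_sum θ hθ z, Finset.sum_eq_single i (fun j _ h => by rw [hj j h, zero_mul]) (by simp),
    hi, one_mul]

/-- Exactly one selector is active, so even a nonlinear `ψ` passes through the sum. -/
theorem IsPL.comp_eq_sum (hG : IsPL Θ G D) (ψ : ℝ → ℝ) {θ : EuclideanSpace ℝ (Fin m)}
    (hθ : θ ∈ Θ) (x : ℝ) (z : EuclideanSpace ℝ (Fin d)) :
    ψ (G θ z + x) = ∑ i, D.selector i θ z * ψ (D.Λ i (D.T θ + z) + D.b i + x) := by
  obtain ⟨i, hi, hj, hGi⟩ := hG.exists_active_piece hθ z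
  rw [Finset.sum_eq_single i (fun j _ h => by rw [hj j h, zero_mul]) (by simp), hi, one_mul, hGi]

theorem abs_mul_sub_mul_le {a a' b b' C : ℝ} (ha : a = 0 ∨ a = 1) (hb' : |b'| ≤ C) :
    |a * b - a' * b'| ≤ |b - b'| + C * |a - a'| := by
  have h : a * b - a' * b' = a * (b - b') + (a - a') * b' := by ring
  rw [h]
  refine (abs_add_le _ _).trans (add_le_add ?_ ?_)
  · rcases ha with rfl | rfl <;> simp
  · rw [abs_mul, mul_comm]
    exact mul_le_mul_of_nonneg_right hb' (abs_nonneg _)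

theorem forall_comp_le_or_forall_comp_le {X : Type*} {ψ : ℝ → ℝ} (hψ : Monotone ψ) {f g : X → ℝ}
    (c : ℝ) (hfg : ∀ z, f z + c = g z) :
    (∀ z, ψ (f z) ≤ ψ (g z)) ∨ ∀ z, ψ (g z) ≤ ψ (f z) := by
  rcases le_total 0 c with h | h
  · exact Or.inl fun z => hψ (by linarith [hfg z])
  · exact Or.inr fun z => hψ (by linarith [hfg z])

/-- Number of one-parameter chains that generate the composed class. -/
def PLData.chainCount (D : PLData m d) : ℕ :=
  Fintype.card ((i : Fin D.r) × Option (Fin (D.s i)))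

theorem IsPL.chainCount_pos (hG : IsPL Θ G D) : 0 < D.chainCount :=
  Fintype.card_pos_iff.2 ⟨⟨⟨0, hG.r_pos⟩, none⟩⟩

/-- Keeping `ψ` arbitrary serves both `Φ*` and its truncation. -/
theorem IsPL.coveringNumber_le (hG : IsPL Θ G D) {ψ : ℝ → ℝ} (hψ : Monotone ψ) (k : ℕ)
    {C : EuclideanSpace ℝ (Fin d) → ℝ} (hC : ∀ z, 0 < C z)
    (hψC : ∀ θ ∈ Θ, ∀ x ∈ Set.Icc (-(k : ℝ)) k, ∀ i z,
      |ψ (D.Λ i (D.T θ + z) + D.b i + x)| ≤ C z)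
    {Q : Measure (EuclideanSpace ℝ (Fin d))} (hQ : Q ∈ finSupportMeasures d)
    {ε : ℝ} (hε : 0 < ε) {n : ℕ} (hn : 4 * (D.chainCount : ℝ) ^ 2 / ε ^ 2 < n) :
    coveringNumber (ENNReal.ofReal ε * eLpNorm C 2 Q)
      {h | ∃ θ ∈ Θ, ∃ x ∈ Set.Icc (-(k : ℝ)) k, h = fun z => ψ (G θ z + x)} Q
      ≤ ((n ^ D.chainCount : ℕ) : ℕ∞) := by
  obtain ⟨hprob, S, hS⟩ := hQ
  let h : Θ × Set.Icc (-(k : ℝ)) k → EuclideanSpace ℝ (Fin d) → ℝ :=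
    fun p z => ψ (G p.1 z + p.2)
  have hrange : {h | ∃ θ ∈ Θ, ∃ x ∈ Set.Icc (-(k : ℝ)) k, h = fun z => ψ (G θ z + x)}
      = Set.range h := by
    ext f
    constructor
    · rintro ⟨θ, hθ, x, hx, rfl⟩
      exact ⟨(⟨θ, hθ⟩, ⟨x, hx⟩), rfl⟩
    · rintro ⟨p, rfl⟩
      exact ⟨p.1, p.1.2, p.2, p.2.2, rfl⟩
  -- The factor `C` gives the indicator chains the common envelope and matches the term `C * |a -
  -- a'|` of `abs_mul_sub_mul_le`.
  let u : ((i : Fin D.r) × Option (Fin (D.s i))) → Θ × Set.Icc (-(k : ℝ)) k →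
      EuclideanSpace ℝ (Fin d) → ℝ := fun j p z =>
    match j with
    | ⟨i, none⟩ => ψ (D.Λ i (D.T p.1 + z) + D.b i + p.2)
    | ⟨i, some l⟩ =>
      C z * (D.I i l).indicator (fun _ => (1 : ℝ)) (D.L i l (D.T p.1 + z) + D.a i l)
  rw [hrange]
  refine coveringNumber_range_le_of_chains hS hC h u ?_ ?_ ?_ hε hn
  · rintro ⟨i, _ | l⟩ p z
    · exact hψC p.1 p.1.2 p.2 p.2.2 i z
    · change |C z * _| ≤ C z
      rcases indicator_one_eq_zero_or_one (D.I i l) (D.L i l (D.T p.1 + z) + D.a i l) with h | h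
      · rw [h, mul_zero, abs_zero]; exact (hC z).le
      · rw [h, mul_one, abs_of_pos (hC z)]
  · rintro ⟨i, _ | l⟩ p q
    · exact forall_comp_le_or_forall_comp_le hψ
        (f := fun z => D.Λ i (D.T p.1 + z) + D.b i + p.2)
        (g := fun z => D.Λ i (D.T q.1 + z) + D.b i + q.2)
        (D.Λ i (D.T q.1) + q.2 - (D.Λ i (D.T p.1) + p.2))
        fun z => by rw [map_add, map_add]; ring
    · exact (forall_comp_le_or_forall_comp_le (hG.indicator_monotone i l)
        (f := fun z => D.L i l (D.T p.1 + z) + D.a i l)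
        (g := fun z => D.L i l (D.T q.1 + z) + D.a i l)
        (D.L i l (D.T q.1) - D.L i l (D.T p.1))
        fun z => by rw [map_add, map_add]; ring).imp
        (fun H z => mul_le_mul_of_nonneg_left (H z) (hC z).le)
        (fun H z => mul_le_mul_of_nonneg_left (H z) (hC z).le)
  · intro p q z
    change |ψ (G p.1 z + p.2) - ψ (G q.1 z + q.2)| ≤ _
    rw [hG.comp_eq_sum ψ p.1.2, hG.comp_eq_sum ψ q.1.2, ← Finset.sum_sub_distrib,
      Fintype.sum_sigma]
    refine (Finset.abs_sum_le_sum_abs _ _).trans (Finset.sum_le_sum fun i _ => ?_)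
    rw [Fintype.sum_option]
    refine (abs_mul_sub_mul_le (hG.selector_eq_zero_or_one i _ z)
      (hψC q.1 q.1.2 q.2 q.2.2 i z)).trans (add_le_add le_rfl ?_)
    refine (mul_le_mul_of_nonneg_left (hG.abs_selector_sub_le i p.1 q.1 z) (hC z).le).trans ?_
    rw [Finset.mul_sum]
    refine Finset.sum_le_sum fun l _ => ?_
    change _ ≤ |C z * _ - C z * _|
    rw [← mul_sub, abs_mul, abs_of_pos (hC z)]

/-- Compactness of `Θ` bounds all shifts at once; `M > 0` lets the integrability assumption be
applied with `η = M`. -/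
theorem PLData.exists_shift_bound (D : PLData m d) (hΘ : IsCompact Θ) (k : ℕ) :
    ∃ M : ℝ, 0 < M ∧ ∀ θ ∈ Θ, ∀ x ∈ Set.Icc (-(k : ℝ)) k, ∀ i,
      D.Λ i (D.T θ) + D.b i + x ≤ M := by
  have hbdd : ∀ i, ∃ B : ℝ, ∀ θ ∈ Θ, D.Λ i (D.T θ) ≤ B := fun i => by
    have hc : Continuous fun θ => D.Λ i (D.T θ) :=
      ((D.Λ i).comp D.T).continuous_of_finiteDimensional
    obtain ⟨B, hB⟩ := (hΘ.image hc).bddAbove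
    exact ⟨B, fun θ hθ => hB ⟨θ, hθ, rfl⟩⟩
  choose B hB using hbdd
  refine ⟨∑ i, |B i + D.b i| + k + 1, by positivity, fun θ hθ x hx i => ?_⟩
  have h1 := Finset.single_le_sum (fun i _ => abs_nonneg (B i + D.b i)) (Finset.mem_univ i)
  linarith [hB i θ hθ, hx.2, le_abs_self (B i + D.b i)]

end PiecewiseLinear

/-! ### Arithmetic of the constants -/

section Constants

/-- Either `c t² < 1` and the floor vanishes, or the added 1 is absorbed by `c t² + 1 ≤ 2 c t²`. -/
theorem floor_add_one_le_of_one_le {t c : ℝ} (ht : 1 ≤ t) (hc : 2 * c ≤ 1) :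
    ((⌊c * t ^ 2⌋₊ + 1 : ℕ) : ℝ) ≤ t ^ 2 := by
  have ht2 : 1 ≤ t ^ 2 := one_le_pow₀ ht
  rcases lt_or_ge (c * t ^ 2) 1 with h | h
  · rw [Nat.floor_eq_zero.2 h]; simpa using ht2
  · push_cast
    have := Nat.floor_le (zero_le_one.trans h)
    nlinarith

theorem ennreal_coe_le_ofReal {N : ℕ∞} {n : ℕ} {y : ℝ} (hN : N ≤ n) (hn : (n : ℝ) ≤ y) :
    (N : ℝ≥0∞) ≤ ENNReal.ofReal y := by
  have h1 : (N : ℝ≥0∞) ≤ ((n : ℕ∞) : ℝ≥0∞) := ENat.toENNReal_mono hN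
  refine h1.trans ?_
  rw [ENat.toENNReal_coe, ← ENNReal.ofReal_natCast]
  exact ENNReal.ofReal_le_ofReal hn

end Constants

end SAA

/-! ### The main theorem -/

open SAA MeasureTheory in
theorem mainTheorem8 {m d : ℕ} (Φ : ℝ≥0 → ℝ≥0∞) (hΦ : SAA.IsDivergenceFunction Φ)
    (Θ : Set (EuclideanSpace ℝ (Fin m))) (hΘ : IsCompact Θ)
    (G : EuclideanSpace ℝ (Fin m) → EuclideanSpace ℝ (Fin d) → ℝ)
    (D : SAA.PLData m d) (hG : SAA.IsPL Θ G D)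
    (PZ : MeasureTheory.Measure (EuclideanSpace ℝ (Fin d)))
    [MeasureTheory.IsProbabilityMeasure PZ] (k : ℕ) :
    ∃ (K V : ℝ) (C : EuclideanSpace ℝ (Fin d) → ℝ), 1 < K ∧ 1 < V ∧
      SAA.IsPositiveEnvelope (SAA.lossClass Φ Θ G k) C ∧
      (∀ ε : ℝ, 0 < ε → ε < 1 →
        (⨆ Q ∈ SAA.finSupportMeasures d,
            ((SAA.coveringNumber (ENNReal.ofReal ε * MeasureTheory.eLpNorm C 2 Q)
              (SAA.lossClass Φ Θ G k) Q : ℕ∞) : ℝ≥0∞))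
          ≤ ENNReal.ofReal (K * (1 / ε) ^ V)) ∧
      (∀ δ : ℝ, 0 < δ → ∀ ε : ℝ, 0 < ε → ε < 6 * D.r * K * (δ + 1 + (Φ 0).toReal) →
        (⨆ Q ∈ SAA.finSupportMeasures d,
            ((SAA.coveringNumber (ENNReal.ofReal ε)
              (SAA.truncClass (SAA.lossClass Φ Θ G k) δ) Q : ℕ∞) : ℝ≥0∞))
          ≤ ENNReal.ofReal ((6 * D.r * K * (δ + 1 + (Φ 0).toReal) / ε) ^ (V + 1))) ∧
      ((∀ i : Fin D.r, ∀ η : ℝ, 0 < η →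
          MeasureTheory.MemLp (fun z => SAA.conj Φ (D.Λ i z + η)) 2 PZ) →
        MeasureTheory.MemLp C 2 PZ) := by
  obtain ⟨M, hM0, hM⟩ := D.exists_shift_bound hΘ k
  set c₀ : ℝ := (Φ 0).toReal with hc₀_def
  have hc₀ : 0 ≤ c₀ := ENNReal.toReal_nonneg
  have hmono := hΦ.conj_monotone
  set J : ℕ := D.chainCount with hJ_def
  have hJ : (1 : ℝ) ≤ J := by exact_mod_cast hG.chainCount_pos
  have hr : (1 : ℝ) ≤ D.r := by exact_mod_cast hG.r_pos
  have hJ2 : (1 : ℝ) ≤ (J : ℝ) ^ 2 := one_le_pow₀ hJ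
  -- The 5 is 4 + 1: rounding `4J²/ε²` up to an integer costs at most `1 ≤ J²/ε²`.
  set K : ℝ := (5 * (J : ℝ) ^ 2) ^ J with hK_def
  have hK : 5 * (J : ℝ) ^ 2 ≤ K :=
    le_self_pow₀ (by linarith) (Nat.pos_iff_ne_zero.1 hG.chainCount_pos)
  -- By monotonicity the sum dominates from above; `c₀` handles the lower bound, and the 1 ensures
  -- positivity.
  let C : EuclideanSpace ℝ (Fin d) → ℝ := fun z => c₀ + 1 + ∑ i, |conj Φ (D.Λ i z + M)|
  have hCpos : ∀ z, 0 < C z := fun z =>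
    add_pos_of_pos_of_nonneg (by linarith) (Finset.sum_nonneg fun _ _ => abs_nonneg _)
  have hCbound : ∀ θ ∈ Θ, ∀ x ∈ Set.Icc (-(k : ℝ)) k, ∀ i z,
      |conj Φ (D.Λ i (D.T θ + z) + D.b i + x)| ≤ C z := by
    intro θ hθ x hx i z
    have h1 : conj Φ (D.Λ i (D.T θ + z) + D.b i + x) ≤ conj Φ (D.Λ i z + M) := by
      refine hmono ?_
      rw [map_add]; linarith [hM θ hθ x hx i]
    have h2 := hΦ.neg_le_conj (D.Λ i (D.T θ + z) + D.b i + x)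
    have h3 := Finset.single_le_sum (fun i _ => abs_nonneg (conj Φ (D.Λ i z + M)))
      (Finset.mem_univ i)
    have h4 := le_abs_self (conj Φ (D.Λ i z + M))
    have h5 := abs_nonneg (conj Φ (D.Λ i z + M))
    simp only [C]
    rw [abs_le]; constructor <;> linarith
  refine ⟨K, 2 * J, C, by linarith, by linarith, ⟨?_, hCpos, ?_⟩, ?_, ?_, ?_⟩
  · refine measurable_const.add (Finset.measurable_sum _ fun i _ => ?_)
    have hΛ : Measurable (D.Λ i) := (D.Λ i).continuous_of_finiteDimensional.measurable
    exact continuous_abs.measurable.comp (hmono.measurable.comp (hΛ.add_const M))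
  · rintro _ ⟨θ, hθ, x, hx, rfl⟩ z
    obtain ⟨i, -, -, hi⟩ := hG.exists_active_piece hθ z
    change |conj Φ (G θ z + x)| ≤ C z
    rw [hi]
    exact hCbound θ hθ x hx i z
  · intro ε hε hε1
    refine iSup₂_le fun Q hQ => ennreal_coe_le_ofReal
      (hG.coveringNumber_le hmono k hCpos hCbound hQ hε
        (n := ⌊4 * (J : ℝ) ^ 2 / ε ^ 2⌋₊ + 1) (by exact_mod_cast Nat.lt_floor_add_one _)) ?_
    have hε2 : 1 ≤ (1 / ε) ^ 2 := one_le_pow₀ ((one_le_div hε).2 hε1.le)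
    have hn : ((⌊4 * (J : ℝ) ^ 2 / ε ^ 2⌋₊ + 1 : ℕ) : ℝ) ≤ 5 * (J : ℝ) ^ 2 * (1 / ε) ^ 2 := by
      have h1 := Nat.floor_le (a := 4 * (J : ℝ) ^ 2 / ε ^ 2) (by positivity)
      have h2 : 4 * (J : ℝ) ^ 2 / ε ^ 2 = 4 * (J : ℝ) ^ 2 * (1 / ε) ^ 2 := by
        rw [one_div, inv_pow, div_eq_mul_inv]
      push_cast
      nlinarith
    have hpow : (1 / ε) ^ (2 * (J : ℝ)) = ((1 / ε) ^ 2) ^ J := by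
      rw [← pow_mul, ← Real.rpow_natCast]; push_cast; rfl
    rw [hpow, hK_def, ← mul_pow, Nat.cast_pow]
    exact pow_le_pow_left₀ (Nat.cast_nonneg _) hn _
  · intro δ hδ ε hε hεlt
    set B : ℝ := δ + 1 + c₀ with hB_def
    have hB : 0 < B := by positivity
    have hψ : Monotone fun y => min (conj Φ y) δ := fun y y' h => min_le_min (hmono h) le_rfl
    have hset : truncClass (lossClass Φ Θ G k) δ
        = {h | ∃ θ ∈ Θ, ∃ x ∈ Set.Icc (-(k : ℝ)) k, h = fun z => min (conj Φ (G θ z + x)) δ} := by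
      ext f
      constructor
      · rintro ⟨_, ⟨θ, hθ, x, hx, rfl⟩, rfl⟩
        exact ⟨θ, hθ, x, hx, rfl⟩
      · rintro ⟨θ, hθ, x, hx, rfl⟩
        exact ⟨_, ⟨θ, hθ, x, hx, rfl⟩, rfl⟩
    have hbound : ∀ θ ∈ Θ, ∀ x ∈ Set.Icc (-(k : ℝ)) k, ∀ i (z : EuclideanSpace ℝ (Fin d)),
        |min (conj Φ (D.Λ i (D.T θ + z) + D.b i + x)) δ| ≤ B := by
      intro θ _ x _ i z
      have h1 := hΦ.neg_le_conj (D.Λ i (D.T θ + z) + D.b i + x)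
      rw [abs_le]
      exact ⟨le_min (by linarith) (by linarith), (min_le_right _ _).trans (by linarith)⟩
    refine iSup₂_le fun Q hQ => ?_
    -- The relative radius is `ε / B`, because the constant envelope `B` has norm `B` under a
    -- probability measure.
    have hcov := hG.coveringNumber_le hψ k (C := fun _ => B) (fun _ => hB) hbound hQ
      (div_pos hε hB) (n := ⌊4 * (J : ℝ) ^ 2 / (ε / B) ^ 2⌋₊ + 1)
      (by exact_mod_cast Nat.lt_floor_add_one _)
    have := hQ.1
    have hnorm : ENNReal.ofReal (ε / B) * eLpNorm (fun _ : EuclideanSpace ℝ (Fin d) => B) 2 Q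
        = ENNReal.ofReal ε := by
      rw [eLpNorm_const _ two_ne_zero (IsProbabilityMeasure.ne_zero Q), measure_univ,
        ENNReal.one_rpow, mul_one, Real.enorm_eq_ofReal hB.le, ← ENNReal.ofReal_mul (by positivity),
        div_mul_cancel₀ _ hB.ne']
    rw [hnorm, ← hset] at hcov
    refine ennreal_coe_le_ofReal hcov ?_
    set t : ℝ := 6 * D.r * K * B / ε with ht_def
    have ht : 1 ≤ t := ((one_lt_div hε).2 hεlt).le
    have hKr : 5 * (J : ℝ) ^ 2 ≤ D.r * K := by nlinarith
    have hrK : 0 < D.r * K := by linarith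
    have hnt : 4 * (J : ℝ) ^ 2 / (ε / B) ^ 2 = 4 * (J : ℝ) ^ 2 / (6 * (D.r * K)) ^ 2 * t ^ 2 := by
      have : K ≠ 0 := by linarith
      have : (D.r : ℝ) ≠ 0 := by linarith
      rw [ht_def]; field_simp
    have hn := floor_add_one_le_of_one_le (c := 4 * (J : ℝ) ^ 2 / (6 * (D.r * K)) ^ 2) ht (by
      rw [← mul_div_assoc, div_le_one (by positivity)]
      nlinarith)
    rw [← hnt] at hn
    have hpow : t ^ (2 * (J : ℝ)) = (t ^ 2) ^ J := by
      rw [← pow_mul, ← Real.rpow_natCast]; push_cast; rfl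
    calc (((⌊4 * (J : ℝ) ^ 2 / (ε / B) ^ 2⌋₊ + 1) ^ J : ℕ) : ℝ)
        ≤ (t ^ 2) ^ J := by
          rw [Nat.cast_pow]
          exact pow_le_pow_left₀ (Nat.cast_nonneg _) hn _
      _ = t ^ (2 * (J : ℝ)) := hpow.symm
      -- The extra 1 in the exponent is slack, harmless since `t ≥ 1`.
      _ ≤ t ^ (2 * (J : ℝ) + 1) := Real.rpow_le_rpow_of_exponent_le ht (by linarith)
  · intro h
    have hconst : MemLp (fun _ : EuclideanSpace ℝ (Fin d) => c₀ + 1) 2 PZ := memLp_const _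
    have hsum : MemLp (fun z => ∑ i, |conj Φ (D.Λ i z + M)|) 2 PZ :=
      memLp_finsetSum _ fun i _ => (h i M hM0).abs
    exact hconst.add hsum
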